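/- For $d\ge 2$ and a complex $d\times d$ matrix $L$, let $\mathcal L_L(\rho)=L\rho L^\dagger-\tfrac12(L^\dagger L\rho+\rho L^\dagger L)$ be the single-operator Lindbladian, $e^{\mathcal L_L t}=\sum_{k\ge 0}\tfrac{t^k}{k!}\mathcal L_L^k$ its evolution, and, when $\|L\|_2=(\operatorname{Tr}[LL^\dagger])^{1/2}=1$, let $\psi_L=|\psi_L\rangle\langle\psi_L|$ with $|\psi_L\rangle=(L\otimes I)|\Gamma\rangle$, $|\Gamma\rangle=\sum_{i=1}^d|i\rangle|i\rangle$, be its program state on $\mathbb C^d\otimes\mathbb C^d$. Let $\tfrac12\|\mathcal N-\mathcal M\|_\diamond=\sup_{R,\rho}\tfrac12\|(\mathrm{id}_R\otimes\mathcal N)(\rho)-(\mathrm{id}_R\otimes\mathcal M)(\rho)\|_1$ be the normalized diamond distance, the supremum being over all finite-dimensional reference systems $R$ and all states $\rho$ of $R$ and the input system, where $\|X\|_1=\operatorname{Tr}[(XX^\dagger)^{1/2}]$. The sample complexity $n_d^*(t,\varepsilon)$ is the least $n\in\mathbb N$ for which there is a quantum channel (completely positive trace-preserving map) $\mathcal P^{(n)}$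 from $\mathbb C^d\otimes(\mathbb C^d\otimes\mathbb C^d)^{\otimes n}$ to $\mathbb C^d$, not depending on $L$, such that $$\tfrac12\left\|\mathcal P^{(n)}\circ\mathcal A_{\psi_L^{\otimes n}}-e^{\mathcal L_L t}\right\|_\diamond\le\varepsilon\quad\text{for all } L\in\mathbb C^{d\times d}\text{ with }\|L\|_2=1,\qquad \mathcal A_\omega(\zeta)=\zeta\otimes\omega .$$ **Theorem.** For every $d\ge 2$, every $t\ge 0$ and every $\varepsilon\in(0,\min\{0.039,\,0.013\,t\}]$, $$n_d^*(t,\varepsilon)\ \ge\ 10^{-4}\,\frac{t^2}{\varepsilon}.$$ -/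

import Mathlib

open scoped MatrixOrder ComplexOrder ENNReal

noncomputable section

namespace SampleSim

/-- A density operator: a positive semidefinite matrix of trace one. -/
def IsState {ι : Type*} [Fintype ι] (ρ : Matrix ι ι ℂ) : Prop :=
  ρ.PosSemidef ∧ ρ.trace = 1

/-- The trace norm `‖X‖₁ = Tr[(X X†)^{1/2}]`. -/
def traceNorm {ι : Type*} [Fintype ι] [DecidableEq ι] (X : Matrix ι ι ℂ) : ℝ :=
  (CFC.sqrt (X * X.conjTranspose)).trace.re

/-- The Schatten `2`-norm `‖X‖₂ = (Tr[X X†])^{1/2}`. -/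
def schattenTwoNorm {ι : Type*} [Fintype ι] (X : Matrix ι ι ℂ) : ℝ :=
  Real.sqrt (X * X.conjTranspose).trace.re

/-- The map `id_R ⊗ N` acting on matrices over the composite system `R ⊗ A`. -/
def ampliate (R : Type*) {α β : Type*}
    (N : Matrix α α ℂ →ₗ[ℂ] Matrix β β ℂ) :
    Matrix (R × α) (R × α) ℂ →ₗ[ℂ] Matrix (R × β) (R × β) ℂ where
  toFun X := Matrix.of fun p q => N (Matrix.of fun a a' => X (p.1, a) (q.1, a')) p.2 q.2
  map_add' X Y := by
    ext p q
    change N ((Matrix.of fun a a' => X (p.1, a) (q.1, a')) +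
      Matrix.of fun a a' => Y (p.1, a) (q.1, a')) p.2 q.2 = _
    rw [map_add]
    rfl
  map_smul' c X := by
    ext p q
    change N (c • Matrix.of fun a a' => X (p.1, a) (q.1, a')) p.2 q.2 = _
    rw [map_smul]
    rfl

/-- A quantum channel: a completely positive and trace-preserving linear map. -/
structure IsChannel {α β : Type*} [Fintype α] [Fintype β]
    (N : Matrix α α ℂ →ₗ[ℂ] Matrix β β ℂ) : Prop where
  completelyPositive : ∀ (k : ℕ) (X : Matrix (Fin k × α) (Fin k × α) ℂ),
    X.PosSemidef → (ampliate (Fin k) N X).PosSemidef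
  tracePreserving : ∀ X : Matrix α α ℂ, (N X).trace = X.trace

/-- The normalized diamond distance: the supremum, over all states `ρ` of a finite-dimensional
reference together with the input system, of
`(1/2) ‖(id_R ⊗ N)(ρ) - (id_R ⊗ M)(ρ)‖₁`, taken in `[0, ∞]`. -/
def diamondDist {α β : Type*} [Fintype α] [Fintype β] [DecidableEq β]
    (N M : Matrix α α ℂ →ₗ[ℂ] Matrix β β ℂ) : ℝ≥0∞ :=
  ⨆ (k : ℕ) (ρ : Matrix (Fin k × α) (Fin k × α) ℂ) (_ : IsState ρ),
    ENNReal.ofReal ((1 / 2) * traceNorm (ampliate (Fin k) N ρ - ampliate (Fin k) M ρ))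

/-- The single-operator Lindbladian `ρ ↦ L ρ L† - (1/2) (L† L ρ + ρ L† L)`. -/
def lindbladian {ι : Type*} [Fintype ι] [DecidableEq ι] (L : Matrix ι ι ℂ) :
    Matrix ι ι ℂ →ₗ[ℂ] Matrix ι ι ℂ where
  toFun ρ := L * ρ * L.conjTranspose -
    (1 / 2 : ℂ) • (L.conjTranspose * L * ρ + ρ * (L.conjTranspose * L))
  map_add' X Y := by
    simp only [mul_add, add_mul, smul_add]
    abel
  map_smul' c X := by
    simp only [Matrix.mul_smul, Matrix.smul_mul, RingHom.id_apply, smul_sub, smul_add]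
    simp only [smul_comm c]

/-- The exponential series of an endomorphism of a finite-dimensional space converges pointwise. -/
theorem summable_expSeries_of_normed {E : Type*} [NormedAddCommGroup E] [NormedSpace ℂ E]
    [FiniteDimensional ℂ E] (G : E →ₗ[ℂ] E) (t : ℝ) (x : E) :
    Summable fun k : ℕ => ((t : ℂ) ^ k / (k.factorial : ℂ)) • (G ^ k) x := by
  have : CompleteSpace E := FiniteDimensional.complete ℂ E
  let T : E →L[ℂ] E := LinearMap.toContinuousLinearMap G
  have hb : ∀ k : ℕ, ‖(G ^ k) x‖ ≤ ‖T‖ ^ k * ‖x‖ := by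
    intro k
    induction k with
    | zero => simp
    | succ k ih =>
      have h1 : (G ^ (k + 1)) x = T ((G ^ k) x) := by
        rw [pow_succ']
        rfl
      rw [h1, pow_succ', mul_assoc]
      exact (T.le_opNorm _).trans (mul_le_mul_of_nonneg_left ih (norm_nonneg _))
  refine Summable.of_norm_bounded
    (g := fun k : ℕ => (|t| * ‖T‖) ^ k / (k.factorial : ℝ) * ‖x‖)
    ((Real.summable_pow_div_factorial _).mul_right _) ?_
  intro k
  rw [norm_smul, norm_div, norm_pow, Complex.norm_real, Complex.norm_natCast, Real.norm_eq_abs,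
    mul_pow]
  calc |t| ^ k / (k.factorial : ℝ) * ‖(G ^ k) x‖
      ≤ |t| ^ k / (k.factorial : ℝ) * (‖T‖ ^ k * ‖x‖) :=
        mul_le_mul_of_nonneg_left (hb k) (by positivity)
    _ = |t| ^ k * ‖T‖ ^ k / (k.factorial : ℝ) * ‖x‖ := by ring

/-- The exponential series of a linear map on matrices converges at every point. -/
theorem summable_expSeries {ι : Type*} [Fintype ι] [DecidableEq ι]
    (G : Matrix ι ι ℂ →ₗ[ℂ] Matrix ι ι ℂ) (t : ℝ) (ρ : Matrix ι ι ℂ) :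
    Summable fun k : ℕ => ((t : ℂ) ^ k / (k.factorial : ℂ)) • (G ^ k) ρ :=
  @summable_expSeries_of_normed (Matrix ι ι ℂ) Matrix.normedAddCommGroup Matrix.normedSpace
    inferInstance G t ρ

/-- The evolution `e^{G t}(ρ) = ∑ k, (t^k / k!) G^k(ρ)` generated by `G`. -/
def evolution {ι : Type*} [Fintype ι] [DecidableEq ι]
    (G : Matrix ι ι ℂ →ₗ[ℂ] Matrix ι ι ℂ) (t : ℝ) :
    Matrix ι ι ℂ →ₗ[ℂ] Matrix ι ι ℂ where
  toFun ρ := ∑' k : ℕ, ((t : ℂ) ^ k / (k.factorial : ℂ)) • (G ^ k) ρ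
  map_add' X Y := by
    rw [← (summable_expSeries G t X).tsum_add (summable_expSeries G t Y)]
    simp only [map_add, smul_add]
  map_smul' c X := by
    rw [RingHom.id_apply, ← (summable_expSeries G t X).tsum_const_smul c]
    simp only [map_smul, smul_comm c]

/-- The unnormalized maximally entangled vector `|Γ⟩ = ∑ i, |i⟩|i⟩`. -/
def gammaVec (ι : Type*) [DecidableEq ι] : ι × ι → ℂ :=
  fun p => if p.1 = p.2 then 1 else 0

/-- The program vector `|ψ_L⟩ = (L ⊗ I)|Γ⟩`. -/
def programVec {ι : Type*} [Fintype ι] [DecidableEq ι] (L : Matrix ι ι ℂ) : ι × ι → ℂ :=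
  (Matrix.kronecker L (1 : Matrix ι ι ℂ)).mulVec (gammaVec ι)

/-- The program state `ψ_L = |ψ_L⟩⟨ψ_L|`. -/
def programState {ι : Type*} [Fintype ι] [DecidableEq ι] (L : Matrix ι ι ℂ) :
    Matrix (ι × ι) (ι × ι) ℂ :=
  Matrix.vecMulVec (programVec L) (star (programVec L))

/-- The tensor power `κ^{⊗ n}`. -/
def tensorPower {α : Type*} (n : ℕ) (κ : Matrix α α ℂ) :
    Matrix (Fin n → α) (Fin n → α) ℂ :=
  Matrix.of fun f g => ∏ i, κ (f i) (g i)

/-- The appending map `ζ ↦ ζ ⊗ ω`. -/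
def append {ι α : Type*} (ω : Matrix α α ℂ) :
    Matrix ι ι ℂ →ₗ[ℂ] Matrix (ι × α) (ι × α) ℂ where
  toFun ζ := Matrix.kronecker ζ ω
  map_add' X Y := by
    ext p q
    simp [Matrix.kronecker, add_mul]
  map_smul' c X := by
    ext p q
    simp [Matrix.kronecker, mul_assoc]

/-- `P`, acting jointly on a `d`-dimensional input system and `n` copies of a program system,
simulates `e^{𝓛 t}` up to normalized diamond distance `ε` for every single-operator Lindbladian
`𝓛` on the input system, given `n` copies of the (normalized) program state of its Lindblad
operator. The channel `P` does not depend on the Lindblad operator. -/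
def Simulates (d : ℕ) (t ε : ℝ) (n : ℕ)
    (P : Matrix (Fin d × (Fin n → Fin d × Fin d)) (Fin d × (Fin n → Fin d × Fin d)) ℂ →ₗ[ℂ]
      Matrix (Fin d) (Fin d) ℂ) : Prop :=
  IsChannel P ∧ ∀ L : Matrix (Fin d) (Fin d) ℂ, schattenTwoNorm L = 1 →
    diamondDist (P ∘ₗ append (tensorPower n (programState L))) (evolution (lindbladian L) t) ≤
      ENNReal.ofReal ε

/-- The sample complexity `n_d^*(t, ε)` of sample-based single-operator Lindbladian simulation:
the least number of copies with which some channel achieves error at most `ε` (and `⊤` if there is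
no such number). -/
def sampleComplexity (d : ℕ) (t ε : ℝ) : ℕ∞ :=
  ⨅ (n : ℕ) (_ : ∃ P, Simulates d t ε n P), (n : ℕ∞)

end SampleSim

end

/-! The two operators diagonal on levels `i`, `j` with entries `u ∓ iv`, `u ± iv`, where `u² + v² =
1/2`, rotate the coherence in opposite directions at rate `2uv`, but dephase it only at rate `2v²`.
Their program states have overlap `1 - 4v²`. The phase is thus linear in `v`, while the loss of
overlap is quadratic.

Suppose a channel simulates time `t` from `n` copies with error `ε`. Iterating it `m` times reaches
time `T = mt` with error at most `mε` and consumes `nm` copies. For `m ≈ 0.1/ε` and `v = 1/(3T)` the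
error is a small constant and the two outputs differ by a larger constant. Since processing cannot
increase distinguishability, `1 - (1 - 4v²)^(nm)` is bounded below, so `n ≳ 1/(m v²) = 9 m t²`, of
order `t²/ε`.

Distinguishability is controlled by running both simulations as the diagonal blocks of one positive
matrix whose off-diagonal block records the overlap (`IsChannel.trace_block_blockStep`,
`trace_involution_mul_block_sub_le`). Errors add up by `abs_trace_involution_mul_pow_sub_le`, and
`Simulates.exp_mul_sin_le` combines the two. -/

noncomputable section

namespace SampleSim

/-! ### Trace inequalities for positive matrices -/

section Positivity

variable {ι : Type*} [Fintype ι]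

theorem trace_mul_re_nonneg {A W : Matrix ι ι ℂ} (hA : A.PosSemidef) (hW : W.PosSemidef) :
    0 ≤ (W * A).trace.re := by
  classical
  obtain ⟨B, rfl⟩ :=
    CStarAlgebra.nonneg_iff_eq_star_mul_self.mp (Matrix.nonneg_iff_posSemidef.mpr hA)
  rw [Matrix.star_eq_conjTranspose]
  rw [← Matrix.mul_assoc, Matrix.trace_mul_comm, ← Matrix.mul_assoc]
  exact (Complex.le_def.mp (hW.mul_mul_conjTranspose_same B).trace_nonneg).1

/-- If `M` is Hermitian with `M² = s²`, then `M ≤ s`. -/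
theorem posSemidef_smul_one_sub [DecidableEq ι] {M : Matrix ι ι ℂ} (hM : M.IsHermitian)
    {s : ℝ} (hs : 0 < s) (hsq : M * M = ((s ^ 2 : ℝ) : ℂ) • (1 : Matrix ι ι ℂ)) :
    ((s : ℂ) • (1 : Matrix ι ι ℂ) - M).PosSemidef := by
  have hH : ((s : ℂ) • (1 : Matrix ι ι ℂ) - M).conjTranspose = (s : ℂ) • 1 - M := by
    simp [Matrix.conjTranspose_sub, Matrix.conjTranspose_smul, hM.eq]
  have h1 := Matrix.posSemidef_conjTranspose_mul_self ((s : ℂ) • (1 : Matrix ι ι ℂ) - M)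
  -- Since `M² = s²`, `(s - M)² = 2s (s - M)`, so `s - M` is a positive multiple of a square.
  have h2 : (s : ℂ) • (1 : Matrix ι ι ℂ) - M = ((1 / (2 * s) : ℝ) : ℂ) •
      (((s : ℂ) • (1 : Matrix ι ι ℂ) - M).conjTranspose * ((s : ℂ) • (1 : Matrix ι ι ℂ) - M)) := by
    have hs' : (s : ℂ) ≠ 0 := by exact_mod_cast hs.ne'
    rw [hH]
    simp only [sub_mul, mul_sub, Matrix.smul_mul, Matrix.mul_smul, one_mul, mul_one, hsq]
    ext i j
    simp only [Matrix.sub_apply, Matrix.smul_apply, smul_eq_mul]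
    push_cast
    field_simp
    ring
  rw [h2]
  exact h1.smul (by exact_mod_cast (by positivity : (0 : ℝ) ≤ 1 / (2 * s)))

/-- A Hermitian involution `Y` has `|Tr[Y Q]| ≤ Tr Q` on positive semidefinite `Q`. -/
theorem abs_trace_involution_mul_le [DecidableEq ι] {Y Q : Matrix ι ι ℂ} (hY : Y.IsHermitian)
    (hY2 : Y * Y = 1) (hQ : Q.PosSemidef) : |(Y * Q).trace.re| ≤ Q.trace.re := by
  have h1 := trace_mul_re_nonneg hQ
    (posSemidef_smul_one_sub hY one_pos (by simpa using hY2))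
  have h2 := trace_mul_re_nonneg hQ
    (posSemidef_smul_one_sub (M := -Y) hY.neg one_pos (by simpa using hY2))
  simp only [Complex.ofReal_one, one_smul, sub_mul, one_mul, Matrix.trace_sub, neg_mul,
    Matrix.trace_neg, Complex.sub_re, Complex.neg_re] at h1 h2
  rw [abs_le]
  constructor <;> linarith

/-- Jordan decomposition of a Hermitian matrix, with total mass its trace norm. -/
theorem exists_posSemidef_sub_of_isHermitian [DecidableEq ι] {X : Matrix ι ι ℂ}
    (hX : X.IsHermitian) :
    ∃ P Q : Matrix ι ι ℂ, P.PosSemidef ∧ Q.PosSemidef ∧ X = P - Q ∧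
      P.trace.re + Q.trace.re = traceNorm X := by
  have hsa : IsSelfAdjoint X := hX
  refine ⟨X⁺, X⁻, ?_, ?_, (CFC.posPart_sub_negPart X hsa).symm, ?_⟩
  · exact Matrix.nonneg_iff_posSemidef.mp (CFC.posPart_nonneg X)
  · exact Matrix.nonneg_iff_posSemidef.mp (CFC.negPart_nonneg X)
  · have h1 : X * X.conjTranspose = star X * X := by
      rw [Matrix.star_eq_conjTranspose, hX.eq]
    have h2 : CFC.sqrt (X * X.conjTranspose) = CFC.abs X := by rw [h1]; rfl
    rw [traceNorm, h2, ← CFC.posPart_add_negPart X hsa, Matrix.trace_add, Complex.add_re]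

end Positivity

/-! ### Coherent iteration over several programs -/

section Blocks

variable {R α β F : Type*}

/-- The `(a, b)` block of a matrix over a composite system. -/
def block (a b : R) (S : Matrix (R × α) (R × α) ℂ) : Matrix α α ℂ :=
  Matrix.of fun i j => S (a, i) (b, j)

theorem block_ampliate (N : Matrix α α ℂ →ₗ[ℂ] Matrix β β ℂ) (a b : R)
    (S : Matrix (R × α) (R × α) ℂ) : block a b (ampliate R N S) = N (block a b S) := rfl

theorem block_posSemidef {S : Matrix (R × α) (R × α) ℂ} (hS : S.PosSemidef) (a : R) :
    (block a a S).PosSemidef :=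
  hS.submatrix fun i => (a, i)

/-- Append to the `(a, b)` block the operator `|u a⟩⟨u b|`. -/
def blockAppend (u : R → F → ℂ) (S : Matrix (R × α) (R × α) ℂ) :
    Matrix (R × (α × F)) (R × (α × F)) ℂ :=
  Matrix.of fun p q => S (p.1, p.2.1) (q.1, q.2.1) * (u p.1 p.2.2 * star (u q.1 q.2.2))

/-- Repeating the entries of `S` along `F` preserves positivity; the appended operators then amount
to conjugation by the diagonal matrix with entries `u a f`. -/
theorem blockAppend_posSemidef [Fintype R] [Fintype α] [Fintype F]
    (u : R → F → ℂ) {S : Matrix (R × α) (R × α) ℂ} (hS : S.PosSemidef) :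
    (blockAppend u S).PosSemidef := by
  classical
  have h1 := (hS.submatrix fun p : R × (α × F) => (p.1, p.2.1)).mul_mul_conjTranspose_same
    (Matrix.diagonal fun p => u p.1 p.2.2)
  convert h1 using 1
  ext p q
  simp [blockAppend, Matrix.diagonal_conjTranspose]
  ring

theorem trace_block_blockAppend [Fintype α] [Fintype F] (u : R → F → ℂ)
    (S : Matrix (R × α) (R × α) ℂ) (a b : R) :
    (block a b (blockAppend u S)).trace = (block a b S).trace * ∑ f, u a f * star (u b f) := by
  simp [Matrix.trace, block, blockAppend, Fintype.sum_prod_type, Finset.sum_mul_sum]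

theorem block_blockAppend_self (u : R → F → ℂ) (S : Matrix (R × α) (R × α) ℂ) (a : R) :
    block a a (blockAppend u S) =
      append (Matrix.vecMulVec (u a) (star (u a))) (block a a S) := by
  ext p q
  simp [block, blockAppend, append, Matrix.vecMulVec_apply]

/-- One joint step of the channels `P ∘ 𝒜_{u a}` for all `a`, including the coherences. -/
def blockStep (P : Matrix (α × F) (α × F) ℂ →ₗ[ℂ] Matrix α α ℂ) (u : R → F → ℂ)
    (S : Matrix (R × α) (R × α) ℂ) : Matrix (R × α) (R × α) ℂ :=
  ampliate R P (blockAppend u S)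

theorem block_blockStep_self (P : Matrix (α × F) (α × F) ℂ →ₗ[ℂ] Matrix α α ℂ)
    (u : R → F → ℂ) (S : Matrix (R × α) (R × α) ℂ) (a : R) (m : ℕ) :
    block a a ((blockStep P u)^[m] S) =
      ((P ∘ₗ append (Matrix.vecMulVec (u a) (star (u a)))) ^ m) (block a a S) := by
  induction m with
  | zero => simp
  | succ m ih =>
    rw [Function.iterate_succ_apply', blockStep, block_ampliate, block_blockAppend_self, ih,
      pow_succ']
    rfl

variable [Fintype α] [Fintype F]

/-- Complete positivity is used here: the branch index plays the role of the reference system. -/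
theorem IsChannel.blockStep_posSemidef {P : Matrix (α × F) (α × F) ℂ →ₗ[ℂ] Matrix α α ℂ}
    (hP : IsChannel P) {k : ℕ} (u : Fin k → F → ℂ) {S : Matrix (Fin k × α) (Fin k × α) ℂ}
    (hS : S.PosSemidef) (m : ℕ) : ((blockStep P u)^[m] S).PosSemidef := by
  induction m with
  | zero => exact hS
  | succ m ih =>
    rw [Function.iterate_succ_apply']
    exact hP.completelyPositive k _ (blockAppend_posSemidef u ih)

/-- Trace preservation holds for all matrices, hence for off-diagonal blocks too, so each step only
multiplies the trace by the overlap of the two programs. -/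
theorem IsChannel.trace_block_blockStep {P : Matrix (α × F) (α × F) ℂ →ₗ[ℂ] Matrix α α ℂ}
    (hP : IsChannel P) (u : R → F → ℂ) (S : Matrix (R × α) (R × α) ℂ) (a b : R) (m : ℕ) :
    (block a b ((blockStep P u)^[m] S)).trace =
      (block a b S).trace * (∑ f, u a f * star (u b f)) ^ m := by
  induction m with
  | zero => simp
  | succ m ih =>
    rw [Function.iterate_succ_apply', blockStep, block_ampliate, hP.tracePreserving,
      trace_block_blockAppend, ih, pow_succ, mul_assoc]

theorem IsChannel.append_posSemidef {P : Matrix (α × F) (α × F) ℂ →ₗ[ℂ] Matrix α α ℂ}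
    (hP : IsChannel P) (w : F → ℂ) {X : Matrix α α ℂ} (hX : X.PosSemidef) (m : ℕ) :
    (((P ∘ₗ append (Matrix.vecMulVec w (star w))) ^ m) X).PosSemidef := by
  have h := block_posSemidef (hP.blockStep_posSemidef (k := 1) (fun _ => w)
    (hX.submatrix (Prod.snd : Fin 1 × α → α)) m) 0
  rw [block_blockStep_self] at h
  exact h

theorem IsChannel.trace_append {P : Matrix (α × F) (α × F) ℂ →ₗ[ℂ] Matrix α α ℂ}
    (hP : IsChannel P) {w : F → ℂ} (hw : ∑ f, w f * star (w f) = 1) (X : Matrix α α ℂ) (m : ℕ) :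
    (((P ∘ₗ append (Matrix.vecMulVec w (star w))) ^ m) X).trace = X.trace := by
  have h := hP.trace_block_blockStep (R := Fin 1) (fun _ => w)
    (X.submatrix Prod.snd Prod.snd) 0 0 m
  rw [block_blockStep_self, hw, one_pow, mul_one] at h
  exact h

/-- Two diagonal blocks of a positive semidefinite `2 × 2` block matrix are hard to tell apart
when the off-diagonal block has large trace. -/
theorem trace_involution_mul_block_sub_le [DecidableEq α] {Y : Matrix α α ℂ}
    (hY : Y.IsHermitian) (hY2 : Y * Y = 1) {S : Matrix (Fin 2 × α) (Fin 2 × α) ℂ}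
    (hS : S.PosSemidef) (h0 : (block 0 0 S).trace = 1) (h1 : (block 1 1 S).trace = 1)
    {c r s : ℝ} (h01 : (block 0 1 S).trace = c) (h10 : (block 1 0 S).trace = c)
    (hs : 0 < s) (hrs : s ^ 2 = 1 + r ^ 2) :
    (Y * block 0 0 S).trace.re - (Y * block 1 1 S).trace.re ≤ 2 * (s - r * c) := by
  -- With Pauli matrices `M = Z ⊗ Y + r X ⊗ 1`. The two terms anticommute, so `M² = 1 + r²` and `M ≤
  -- s`; pairing with `S` gives the bound. For `|c| < 1` the best `r` would give `2√(1 - c²)`.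
  let M : Matrix (Fin 2 × α) (Fin 2 × α) ℂ :=
    Matrix.kronecker !![1, 0; 0, -1] Y + Matrix.kronecker !![0, (r : ℂ); (r : ℂ), 0] 1
  have hM : M.IsHermitian := by
    have e1 : (!![1, 0; 0, -1] : Matrix (Fin 2) (Fin 2) ℂ).conjTranspose = !![1, 0; 0, -1] := by
      ext i j; fin_cases i <;> fin_cases j <;> simp
    have e2 : (!![0, (r : ℂ); (r : ℂ), 0] : Matrix (Fin 2) (Fin 2) ℂ).conjTranspose =
        !![0, (r : ℂ); (r : ℂ), 0] := by
      ext i j; fin_cases i <;> fin_cases j <;> simp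
    change M.conjTranspose = M
    simp only [M, Matrix.conjTranspose_add, Matrix.kronecker, Matrix.conjTranspose_kronecker]
    rw [e1, e2, hY.eq, Matrix.conjTranspose_one]
  have hM2 : M * M = ((s ^ 2 : ℝ) : ℂ) • (1 : Matrix (Fin 2 × α) (Fin 2 × α) ℂ) := by
    have e0 : (1 : Matrix (Fin 2 × α) (Fin 2 × α) ℂ) =
      Matrix.kroneckerMap (· * ·) (1 : Matrix (Fin 2) (Fin 2) ℂ) (1 : Matrix α α ℂ) := by simp
    simp only [M, Matrix.kronecker, add_mul, mul_add, ← Matrix.mul_kronecker_mul, hY2, mul_one,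
      one_mul]
    rw [e0, hrs]
    ext ⟨i, a⟩ ⟨j, b⟩
    by_cases hab : a = b <;> fin_cases i <;> fin_cases j <;> simp [hab] <;> ring
  have h := trace_mul_re_nonneg hS (posSemidef_smul_one_sub hM hs hM2)
  have hT : ((((s : ℂ) • (1 : Matrix (Fin 2 × α) (Fin 2 × α) ℂ)) - M) * S).trace =
      s * ((block 0 0 S).trace + (block 1 1 S).trace) -
        ((Y * block 0 0 S).trace - (Y * block 1 1 S).trace) -
        r * ((block 0 1 S).trace + (block 1 0 S).trace) := by
    rw [sub_mul, Matrix.trace_sub, Matrix.smul_mul, one_mul, Matrix.trace_smul]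
    simp only [M, add_mul, Matrix.trace_add]
    simp [Matrix.trace, Matrix.mul_apply, Fintype.sum_prod_type, Fin.sum_univ_two, block,
      Matrix.one_apply, Finset.sum_add_distrib, ← Finset.mul_sum]
    ring
  rw [hT, h0, h1, h01, h10] at h
  simp only [Complex.sub_re, Complex.mul_re, Complex.add_re, Complex.ofReal_re, Complex.ofReal_im,
    Complex.one_re, zero_mul, sub_zero] at h
  linarith

end Blocks

/-! ### Accumulation of simulation errors -/

section Approximation

variable {α β : Type*} [Fintype α] [Fintype β] [DecidableEq β]

/-- A bound on the diamond distance, evaluated at a state without reference system. -/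
theorem exists_sub_of_diamondDist_le {N M : Matrix α α ℂ →ₗ[ℂ] Matrix β β ℂ} {ε : ℝ}
    (hε : 0 ≤ ε) (h : diamondDist N M ≤ ENNReal.ofReal ε) {σ : Matrix α α ℂ} (hσ : IsState σ)
    (hH : (N σ - M σ).IsHermitian) :
    ∃ P Q : Matrix β β ℂ, P.PosSemidef ∧ Q.PosSemidef ∧ N σ - M σ = P - Q ∧
      P.trace.re + Q.trace.re ≤ 2 * ε := by
  let ρ : Matrix (Fin 1 × α) (Fin 1 × α) ℂ := σ.submatrix Prod.snd Prod.snd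
  have htr : ∀ X : Matrix (Fin 1 × β) (Fin 1 × β) ℂ, (block 0 0 X).trace = X.trace := by
    intro X
    simp [Matrix.trace, block, Fintype.sum_prod_type]
  have hρ : IsState ρ := by
    refine ⟨hσ.1.submatrix _, ?_⟩
    rw [← hσ.2]
    simp [Matrix.trace, ρ, Fintype.sum_prod_type]
  have hX : (ampliate (Fin 1) N ρ - ampliate (Fin 1) M ρ) =
      (N σ - M σ).submatrix Prod.snd Prod.snd := rfl
  obtain ⟨P, Q, hP, hQ, hPQ, hs⟩ := exists_posSemidef_sub_of_isHermitian
    (X := ampliate (Fin 1) N ρ - ampliate (Fin 1) M ρ) (by rw [hX]; exact hH.submatrix _)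
  refine ⟨block 0 0 P, block 0 0 Q, block_posSemidef hP 0, block_posSemidef hQ 0, ?_, ?_⟩
  · ext i j
    have := congrFun (congrFun hPQ (0, i)) (0, j)
    rw [hX] at this
    exact this
  · rw [htr, htr, hs]
    have h1 : ENNReal.ofReal ((1 / 2) * traceNorm (ampliate (Fin 1) N ρ - ampliate (Fin 1) M ρ))
        ≤ ENNReal.ofReal ε := by
      refine le_trans ?_ h
      exact le_iSup_of_le 1 (le_iSup_of_le ρ (le_iSup_of_le hρ le_rfl))
    have h2 := (ENNReal.ofReal_le_ofReal_iff hε).mp h1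
    linarith

/-- The error of a step is preserved by later applications of a positive trace-preserving map,
so that errors add up. -/
theorem abs_trace_involution_mul_pow_sub_le {E : Module.End ℂ (Matrix β β ℂ)}
    (hpos : ∀ X : Matrix β β ℂ, X.PosSemidef → ∀ m, ((E ^ m) X).PosSemidef)
    (htr : ∀ X m, ((E ^ m) X).trace = X.trace) {Y : Matrix β β ℂ} (hY : Y.IsHermitian)
    (hY2 : Y * Y = 1) {ε : ℝ} {σ : ℕ → Matrix β β ℂ}
    (h : ∀ j, ∃ P Q : Matrix β β ℂ, P.PosSemidef ∧ Q.PosSemidef ∧ E (σ j) - σ (j + 1) = P - Q ∧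
      P.trace.re + Q.trace.re ≤ 2 * ε) (m : ℕ) :
    ∀ j, |(Y * (E ^ m) (σ j)).trace.re - (Y * σ (j + m)).trace.re| ≤ 2 * m * ε := by
  induction m with
  | zero => simp
  | succ m ih =>
    intro j
    obtain ⟨P, Q, hP, hQ, hPQ, hs⟩ := h j
    -- Telescoping: the first step is replaced by the exact one, and its error `P - Q` is carried
    -- along by `E ^ m`, which preserves the positivity and mass of both parts.
    have e1 : (E ^ (m + 1)) (σ j) = (E ^ m) P - (E ^ m) Q + (E ^ m) (σ (j + 1)) := by
      rw [← map_sub, ← map_add, ← hPQ, sub_add_cancel, pow_succ]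
      rfl
    have h1 := abs_trace_involution_mul_le hY hY2 (hpos P hP m)
    have h2 := abs_trace_involution_mul_le hY hY2 (hpos Q hQ m)
    have h3 := ih (j + 1)
    rw [htr] at h1 h2
    rw [e1, show j + (m + 1) = j + 1 + m by ring]
    simp only [mul_add, mul_sub, Matrix.trace_add, Matrix.trace_sub, Complex.add_re,
      Complex.sub_re]
    push_cast
    rw [abs_le] at h1 h2 h3 ⊢
    constructor <;> linarith [h1.1, h1.2, h2.1, h2.2, h3.1, h3.2]

end Approximation

/-! ### Phase rotation and dephasing of a two-level coherence -/

section Dephasing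

variable {ι : Type*} [Fintype ι] [DecidableEq ι]

theorem evolution_of_eigenvector {G : Matrix ι ι ℂ →ₗ[ℂ] Matrix ι ι ℂ} {X : Matrix ι ι ℂ}
    {μ : ℂ} (h : G X = μ • X) (t : ℝ) : evolution G t X = Complex.exp (t * μ) • X := by
  have hk : ∀ k : ℕ, (G ^ k) X = μ ^ k • X := by
    intro k
    induction k with
    | zero => simp
    | succ k ih =>
      rw [pow_succ', Module.End.mul_apply, ih, map_smul, h, smul_smul, pow_succ]
  have hs : HasSum (fun k : ℕ => ((t * μ) ^ k / (k.factorial : ℂ)) • X)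
      (Complex.exp (t * μ) • X) := by
    rw [Complex.exp_eq_exp_ℂ]
    exact (NormedSpace.expSeries_div_hasSum_exp (t * μ : ℂ)).smul_const X
  have he : evolution G t X = ∑' k : ℕ, ((t : ℂ) ^ k / (k.factorial : ℂ)) • (G ^ k) X := rfl
  rw [he, ← hs.tsum_eq]
  congr 1
  ext1 k
  rw [hk, smul_smul]
  congr 1
  ring

theorem lindbladian_diagonal_single (l : ι → ℂ) (i j : ι) (c : ℂ) :
    lindbladian (Matrix.diagonal l) (Matrix.single i j c) =
      (l i * star (l j) - (1 / 2) * (star (l i) * l i + star (l j) * l j)) •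
        Matrix.single i j c := by
  ext a b
  simp only [lindbladian, LinearMap.coe_mk, AddHom.coe_mk, Matrix.diagonal_conjTranspose,
    Matrix.diagonal_mul_diagonal, Matrix.sub_apply, Matrix.add_apply, Matrix.smul_apply,
    Matrix.diagonal_mul, Matrix.mul_diagonal, Matrix.single_apply, smul_eq_mul, Pi.star_apply]
  split_ifs with hab
  · rw [hab.1, hab.2]
    ring
  · ring

/-- The diagonal of a Lindblad operator rotating the phase between levels `i` and `j`. -/
def phaseVec (i j : ι) (u v : ℝ) : ι → ℂ :=
  Pi.single i (u - v * Complex.I) + Pi.single j (u + v * Complex.I)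

/-- Needed for `w = v`, the normalization, and for `w = -v`, the overlap `2(u² - v²)`. -/
theorem sum_phaseVec {i j : ι} (hij : i ≠ j) (u v w : ℝ) :
    ∑ k, phaseVec i j u v k * star (phaseVec i j u w k) = ((2 * (u ^ 2 + v * w) : ℝ) : ℂ) := by
  have h0 : ∀ k, k ≠ i ∧ k ≠ j → phaseVec i j u v k * star (phaseVec i j u w k) = 0 := by
    rintro k ⟨hi, hj⟩
    simp [phaseVec, hi, hj]
  rw [Fintype.sum_eq_add i j hij h0]
  simp only [phaseVec, Pi.add_apply, Pi.single_eq_same, Pi.single_eq_of_ne hij,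
    Pi.single_eq_of_ne hij.symm]
  apply Complex.ext <;> simp [pow_two] <;> ring

/-- A qubit state on levels `i` and `j` with off-diagonal entry `z / 2`. -/
def coherenceState (i j : ι) (z : ℂ) : Matrix ι ι ℂ :=
  (1 / 2 : ℂ) • (Matrix.single i i 1 + Matrix.single j j 1 + z • Matrix.single i j 1 +
    star z • Matrix.single j i 1)

/-- Matrix units are eigenvectors of a diagonal Lindbladian: populations are fixed and coherences
acquire a scalar. The family is therefore invariant and repeated evolution takes powers of one
number. -/
theorem evolution_coherenceState {i j : ι} (hij : i ≠ j) (u v t : ℝ) (z : ℂ) :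
    evolution (lindbladian (Matrix.diagonal (phaseVec i j u v))) t (coherenceState i j z) =
      coherenceState i j
        (Complex.exp (t * ((-2 * v ^ 2 : ℝ) + (-2 * u * v : ℝ) * Complex.I)) * z) := by
  have hi : phaseVec i j u v i = u - v * Complex.I := by simp [phaseVec, hij]
  have hj : phaseVec i j u v j = u + v * Complex.I := by simp [phaseVec, hij.symm]
  have hii := evolution_of_eigenvector
    (lindbladian_diagonal_single (phaseVec i j u v) i i 1) t
  have hjj := evolution_of_eigenvector
    (lindbladian_diagonal_single (phaseVec i j u v) j j 1) t
  have hij' := evolution_of_eigenvector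
    (lindbladian_diagonal_single (phaseVec i j u v) i j 1) t
  have hji := evolution_of_eigenvector
    (lindbladian_diagonal_single (phaseVec i j u v) j i 1) t
  simp only [hi, hj] at hii hjj hij' hji
  set w : ℂ := (-2 * v ^ 2 : ℝ) + (-2 * u * v : ℝ) * Complex.I with hw
  have e1 : ((u : ℂ) - v * Complex.I) * star ((u : ℂ) - v * Complex.I) - 1 / 2 *
      (star ((u : ℂ) - v * Complex.I) * (u - v * Complex.I) +
        star ((u : ℂ) - v * Complex.I) * (u - v * Complex.I)) = 0 := by ring
  have e2 : ((u : ℂ) + v * Complex.I) * star ((u : ℂ) + v * Complex.I) - 1 / 2 *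
      (star ((u : ℂ) + v * Complex.I) * (u + v * Complex.I) +
        star ((u : ℂ) + v * Complex.I) * (u + v * Complex.I)) = 0 := by ring
  have e3 : ((u : ℂ) - v * Complex.I) * star ((u : ℂ) + v * Complex.I) - 1 / 2 *
      (star ((u : ℂ) - v * Complex.I) * (u - v * Complex.I) +
        star ((u : ℂ) + v * Complex.I) * (u + v * Complex.I)) = w := by
    apply Complex.ext <;> simp [hw, pow_two] <;> linarith
  have e4 : ((u : ℂ) + v * Complex.I) * star ((u : ℂ) - v * Complex.I) - 1 / 2 *
      (star ((u : ℂ) + v * Complex.I) * (u + v * Complex.I) +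
        star ((u : ℂ) - v * Complex.I) * (u - v * Complex.I)) = star w := by
    apply Complex.ext <;> simp [hw, pow_two] <;> linarith
  rw [e1, mul_zero, Complex.exp_zero, one_smul] at hii
  rw [e2, mul_zero, Complex.exp_zero, one_smul] at hjj
  rw [e3] at hij'
  rw [e4] at hji
  have e5 : Complex.exp (t * star w) = star (Complex.exp (t * w)) := by
    simp [← Complex.exp_conj]
  simp only [coherenceState, map_smul, map_add, hii, hjj, hij', hji, e5, smul_smul, star_mul']
  rw [mul_comm z, mul_comm (star z)]

theorem coherenceState_isState {i j : ι} (hij : i ≠ j) {z : ℂ} (hz : ‖z‖ ≤ 1) :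
    IsState (coherenceState i j z) := by
  constructor
  -- Twice the state is the projector on `|i⟩ + z̄|j⟩` (unnormalized) plus `(1 - |z|²)|j⟩⟨j|`.
  · have h1 := Matrix.posSemidef_vecMulVec_self_star (Pi.single i 1 + Pi.single j (star z) : ι → ℂ)
    have h2 := Matrix.posSemidef_vecMulVec_self_star (Pi.single j 1 : ι → ℂ)
    have h3 := (h1.add (h2.smul (by
      exact_mod_cast sub_nonneg.mpr (pow_le_one₀ (norm_nonneg z) hz) :
        (0 : ℂ) ≤ ((1 - ‖z‖ ^ 2 : ℝ) : ℂ)))).smul (show (0 : ℂ) ≤ 1 / 2 by positivity)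
    convert h3 using 1
    rw [coherenceState]
    congr 1
    have hn : star z * z = ((‖z‖ ^ 2 : ℝ) : ℂ) := by
      rw [← Complex.normSq_eq_norm_sq, Complex.normSq_eq_conj_mul_self]; rfl
    ext a b
    simp only [Matrix.add_apply, Matrix.smul_apply, Matrix.vecMulVec_apply, Matrix.single_apply,
      Pi.add_apply, Pi.star_apply, Pi.single_apply, smul_eq_mul]
    push_cast at hn ⊢
    rw [← hn]
    by_cases ha : a = i <;> by_cases hb : b = i <;> by_cases ha' : a = j <;>
      by_cases hb' : b = j <;> simp_all [eq_comm]
  · have h1 : (Matrix.single i j (1 : ℂ)).trace = 0 := Matrix.trace_single_eq_of_ne _ _ _ hij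
    have h2 : (Matrix.single j i (1 : ℂ)).trace = 0 := Matrix.trace_single_eq_of_ne _ _ _ hij.symm
    simp only [coherenceState, Matrix.trace_smul, Matrix.trace_add, Matrix.trace_single_eq_same,
      h1, h2, smul_eq_mul]
    norm_num

/-- The Pauli `y` matrix on levels `i` and `j`, completed by the identity. -/
def pauliY (i j : ι) : Matrix ι ι ℂ :=
  1 - Matrix.single i i 1 - Matrix.single j j 1 - Matrix.single i j Complex.I +
    Matrix.single j i Complex.I

theorem pauliY_isHermitian {ι : Type*} [DecidableEq ι] (i j : ι) : (pauliY i j).IsHermitian := by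
  change (pauliY i j).conjTranspose = pauliY i j
  simp only [pauliY, Matrix.conjTranspose_add, Matrix.conjTranspose_sub, Matrix.conjTranspose_one,
    Matrix.conjTranspose_single, star_one, Complex.star_def, Complex.conj_I]
  simp only [← Matrix.single_neg]
  abel

theorem pauliY_mul_self {i j : ι} (hij : i ≠ j) : pauliY i j * pauliY i j = 1 := by
  simp only [pauliY, mul_add, mul_sub, add_mul, sub_mul, one_mul, mul_one,
    Matrix.single_mul_single_same, Matrix.single_mul_single_of_ne _ _ _ _ hij,
    Matrix.single_mul_single_of_ne _ _ _ _ hij.symm, Complex.I_mul_I]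
  simp only [← Matrix.single_neg]
  abel

theorem trace_pauliY_mul_coherenceState {i j : ι} (hij : i ≠ j) (z : ℂ) :
    (pauliY i j * coherenceState i j z).trace.re = -z.im := by
  have h1 : ∀ c : ℂ, (Matrix.single i j c).trace = 0 :=
    fun _ => Matrix.trace_single_eq_of_ne _ _ _ hij
  have h2 : ∀ c : ℂ, (Matrix.single j i c).trace = 0 :=
    fun _ => Matrix.trace_single_eq_of_ne _ _ _ hij.symm
  simp only [pauliY, coherenceState, mul_add, add_mul, sub_mul, one_mul, mul_one,
    Matrix.mul_smul, Matrix.smul_single,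
    Matrix.single_mul_single_same, Matrix.single_mul_single_of_ne _ _ _ _ hij,
    Matrix.single_mul_single_of_ne _ _ _ _ hij.symm, Matrix.trace_smul, Matrix.trace_add,
    Matrix.trace_sub, Matrix.trace_single_eq_same, h1, h2, Matrix.trace_zero]
  simp
  ring

end Dephasing

/-! ### Overlaps of program states -/

section Programs

variable {ι : Type*} [Fintype ι] [DecidableEq ι]

theorem programVec_apply (L : Matrix ι ι ℂ) (p : ι × ι) : programVec L p = L p.1 p.2 := by
  simp [programVec, Matrix.mulVec, dotProduct, gammaVec, Matrix.kronecker, Fintype.sum_prod_type,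
    Matrix.one_apply]

/-- The vector of `n` copies of the program state. -/
def programPowVec (n : ℕ) (L : Matrix ι ι ℂ) : (Fin n → ι × ι) → ℂ :=
  fun f => ∏ i, programVec L (f i)

theorem tensorPower_programState (n : ℕ) (L : Matrix ι ι ℂ) :
    tensorPower n (programState L) =
      Matrix.vecMulVec (programPowVec n L) (star (programPowVec n L)) := by
  ext f g
  simp [tensorPower, programState, programPowVec, Matrix.vecMulVec_apply, Finset.prod_mul_distrib]

theorem sum_programPowVec_diagonal (n : ℕ) (k l : ι → ℂ) :
    ∑ f, programPowVec n (Matrix.diagonal k) f * star (programPowVec n (Matrix.diagonal l) f) =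
      (∑ i, k i * star (l i)) ^ n := by
  have h : ∑ i, k i * star (l i) = ∑ p : ι × ι, programVec (Matrix.diagonal k) p *
      star (programVec (Matrix.diagonal l) p) := by
    simp [programVec_apply, Fintype.sum_prod_type, Matrix.diagonal_apply]
  rw [h, Fintype.sum_pow]
  simp [programPowVec, Finset.prod_mul_distrib]

theorem schattenTwoNorm_diagonal (l : ι → ℂ) (h : ∑ i, l i * star (l i) = 1) :
    schattenTwoNorm (Matrix.diagonal l) = 1 := by
  have : (Matrix.diagonal l * (Matrix.diagonal l).conjTranspose).trace = 1 := by
    rw [Matrix.diagonal_conjTranspose, Matrix.diagonal_mul_diagonal, Matrix.trace_diagonal]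
    exact h
  rw [schattenTwoNorm, this, Complex.one_re, Real.sqrt_one]

end Programs

/-! ### The lower bound -/

section LowerBound

open Real

variable {d n : ℕ} {t ε : ℝ}

/-- Two Lindblad operators with opposite phases, simulated `m` times in a row: the phase that the
evolutions accumulate is limited by the distinguishability of the consumed program states. -/
theorem Simulates.exp_mul_sin_le {P} (hP : Simulates d t ε n P) (hε : 0 ≤ ε) (ht : 0 ≤ t)
    {i j : Fin d} (hij : i ≠ j) {u v : ℝ} (huv : u ^ 2 + v ^ 2 = 1 / 2) (m : ℕ) {r s : ℝ}
    (hs : 0 < s) (hrs : s ^ 2 = 1 + r ^ 2) :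
    exp (-2 * v ^ 2 * (m * t)) * sin (2 * u * v * (m * t)) ≤
      s - r * (1 - 4 * v ^ 2) ^ (n * m) + 2 * m * ε := by
  let ω : ℝ → (Fin n → Fin d × Fin d) → ℂ :=
    fun w => programPowVec n (Matrix.diagonal (phaseVec i j u w))
  let E : ℝ → Module.End ℂ (Matrix (Fin d) (Fin d) ℂ) :=
    fun w => P ∘ₗ append (Matrix.vecMulVec (ω w) (star (ω w)))
  let ζ : ℝ → ℂ := fun w => Complex.exp (t * ((-2 * w ^ 2 : ℝ) + (-2 * u * w : ℝ) * Complex.I))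
  have hζ : ∀ (w : ℝ) (k : ℕ), ζ w ^ k = Complex.exp ((-2 * w ^ 2 * (k * t) : ℝ) +
      (-2 * u * w * (k * t) : ℝ) * Complex.I) := by
    intro w k
    simp only [ζ]
    rw [← Complex.exp_nat_mul]
    congr 1
    push_cast
    ring
  have hζn : ∀ (w : ℝ) (k : ℕ), ‖ζ w ^ k‖ ≤ 1 := by
    intro w k
    rw [hζ, Complex.norm_exp]
    simp only [Complex.add_re, Complex.ofReal_re, Complex.mul_re, Complex.I_re, mul_zero,
      Complex.ofReal_im, Complex.I_im, mul_one, sub_self, add_zero]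
    rw [exp_le_one_iff]
    have : 0 ≤ w ^ 2 * (k * t) := by positivity
    linarith
  have hζi : ∀ (w : ℝ) (k : ℕ), (ζ w ^ k).im =
      exp (-2 * w ^ 2 * (k * t)) * sin (-2 * u * w * (k * t)) := by
    intro w k
    rw [hζ, Complex.exp_im]
    simp only [Complex.add_re, Complex.add_im, Complex.ofReal_re, Complex.mul_re, Complex.mul_im,
      Complex.I_re, mul_zero, Complex.ofReal_im, Complex.I_im, mul_one, sub_self, add_zero,
      zero_add]
  have hω : ∀ w w', ∑ f, ω w f * star (ω w' f) = ((2 * (u ^ 2 + w * w') : ℝ) : ℂ) ^ n := by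
    intro w w'
    rw [sum_programPowVec_diagonal, sum_phaseVec hij]
  have hω1 : ∀ w, u ^ 2 + w ^ 2 = 1 / 2 → ∑ f, ω w f * star (ω w f) = 1 := by
    intro w hw
    rw [hω, show 2 * (u ^ 2 + w * w) = 1 by linarith]
    simp
  -- The plus sign appears because `pauliY` has expectation `-Im z` in `coherenceState i j z`.
  have herr : ∀ w, u ^ 2 + w ^ 2 = 1 / 2 →
      |(pauliY i j * (E w ^ m) (coherenceState i j 1)).trace.re + (ζ w ^ m).im| ≤
        2 * m * ε := by
    intro w hw
    have h := abs_trace_involution_mul_pow_sub_le (E := E w) (ε := ε)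
      (fun X hX m => hP.1.append_posSemidef (ω w) hX m)
      (fun X m => hP.1.trace_append (hω1 w hw) X m)
      (pauliY_isHermitian i j) (pauliY_mul_self hij)
      (σ := fun k => coherenceState i j (ζ w ^ k)) ?_ m 0
    · simpa [trace_pauliY_mul_coherenceState hij] using h
    · intro k
      have hst := coherenceState_isState hij (hζn w k)
      have hst' := coherenceState_isState hij (hζn w (k + 1))
      have hev : evolution (lindbladian (Matrix.diagonal (phaseVec i j u w))) t
          (coherenceState i j (ζ w ^ k)) = coherenceState i j (ζ w ^ (k + 1)) := by
        rw [evolution_coherenceState hij, _root_.pow_succ' (ζ w)]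
      have hd := hP.2 (Matrix.diagonal (phaseVec i j u w)) (schattenTwoNorm_diagonal _ (by
        rw [sum_phaseVec hij, show 2 * (u ^ 2 + w * w) = 1 by linarith]; simp))
      rw [tensorPower_programState] at hd
      have hE := hP.1.append_posSemidef (ω w) hst.1 1
      rw [pow_one] at hE
      have := exists_sub_of_diamondDist_le hε hd hst (by
        rw [hev]; exact hE.isHermitian.sub hst'.1.isHermitian)
      rw [hev] at this
      exact this
  have hv : u ^ 2 + (-v) ^ 2 = 1 / 2 := by linarith [neg_sq v]
  -- Two branches with opposite phases start from the same input; all four blocks of `S` are equal.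
  let U : Fin 2 → (Fin n → Fin d × Fin d) → ℂ := ![ω v, ω (-v)]
  let S : Matrix (Fin 2 × Fin d) (Fin 2 × Fin d) ℂ :=
    (coherenceState i j 1).submatrix Prod.snd Prod.snd
  have h1 := coherenceState_isState hij (z := 1) (by simp)
  have hS : S.PosSemidef := h1.1.submatrix _
  have hblock : ∀ a b, block a b S = coherenceState i j 1 := fun _ _ => rfl
  have htr : ∀ a b, (block a b ((blockStep P U)^[m] S)).trace =
      (∑ f, U a f * star (U b f)) ^ m := by
    intro a b
    rw [hP.1.trace_block_blockStep, hblock, h1.2, one_mul]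
  have hc : ∀ w, w ^ 2 = v ^ 2 → (((2 * (u ^ 2 + w * -w) : ℝ) : ℂ) ^ n) ^ m =
      (((1 - 4 * v ^ 2) ^ (n * m) : ℝ) : ℂ) := by
    intro w hw
    rw [show 2 * (u ^ 2 + w * -w) = 1 - 4 * v ^ 2 by linarith, ← pow_mul]
    push_cast
    rfl
  have key := trace_involution_mul_block_sub_le (pauliY_isHermitian i j) (pauliY_mul_self hij)
    (hP.1.blockStep_posSemidef U hS m)
    (by rw [htr, show U 0 = ω v from rfl, hω1 _ huv, one_pow])
    (by rw [htr, show U 1 = ω (-v) from rfl, hω1 _ hv, one_pow])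
    (c := (1 - 4 * v ^ 2) ^ (n * m))
    (by
      rw [htr]
      change (∑ f, ω v f * star (ω (-v) f)) ^ m = _
      rw [hω, ← hc v rfl])
    (by
      rw [htr]
      change (∑ f, ω (-v) f * star (ω v f)) ^ m = _
      rw [hω, ← hc (-v) (neg_sq v), neg_neg])
    hs hrs
  rw [block_blockStep_self, block_blockStep_self, hblock, hblock] at key
  have e0 := herr (-v) hv
  have e1 := herr v huv
  rw [hζi] at e0 e1
  change (pauliY i j * (E v ^ m) (coherenceState i j 1)).trace.re -
    (pauliY i j * (E (-v) ^ m) (coherenceState i j 1)).trace.re ≤ _ at key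
  rw [show -2 * u * -v * (m * t) = 2 * u * v * (m * t) by ring, neg_sq] at e0
  rw [show -2 * u * v * (m * t) = -(2 * u * v * (m * t)) by ring, sin_neg] at e1
  rw [abs_le] at e0 e1
  linarith [e0.1, e0.2, e1.1, e1.2]

theorem Simulates.le_natCast {P} (hP : Simulates d t ε n P) (hd : 2 ≤ d)
    (hε0 : 0 < ε) (hε1 : ε ≤ 0.039) (hε2 : ε ≤ 0.013 * t) :
    (10 : ℝ) ^ (-4 : ℤ) * (t ^ 2 / ε) ≤ n := by
  by_contra! hn
  have ht : 0 < t := by linarith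
  -- Rounding up adds at most `ε ≤ 0.039` to the target `0.1`.
  obtain ⟨m, hm1, hm2⟩ : ∃ m : ℕ, 0.1 ≤ m * ε ∧ m * ε ≤ 0.139 := by
    refine ⟨⌈0.1 / ε⌉₊, ?_, ?_⟩
    · rw [← div_le_iff₀ hε0]
      exact Nat.le_ceil _
    · have h := (Nat.ceil_lt_add_one (show 0 ≤ 0.1 / ε by positivity)).le
      calc (⌈0.1 / ε⌉₊ : ℝ) * ε ≤ (0.1 / ε + 1) * ε := by gcongr
        _ = 0.1 + ε := by field_simp
        _ ≤ 0.139 := by linarith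
  have hm0 : (0 : ℝ) < m := pos_of_mul_pos_left (by linarith) hε0.le
  set T : ℝ := m * t with hT
  have hT1 : 7.69 ≤ T := by nlinarith
  have hT0 : 0 < T := by linarith
  -- The phase `2uvT = 2u/3 ≈ 0.47` is then of constant size, while the dephasing exponent `2v²T =
  -- 2v/3` stays below `0.03`.
  set v : ℝ := 1 / (3 * T) with hv
  have hvT : v * T = 1 / 3 := by rw [hv]; field_simp
  have hv0 : 0 < v := by positivity
  have hv1 : v ≤ 0.0434 := by nlinarith
  set u : ℝ := sqrt (1 / 2 - v ^ 2) with hu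
  have huv : u ^ 2 + v ^ 2 = 1 / 2 := by
    rw [hu, sq_sqrt (by nlinarith)]
    ring
  have hu0 : 0 ≤ u := sqrt_nonneg _
  have hu1 : 0.7 ≤ u := by nlinarith
  have hu2 : u ≤ 0.7072 := by nlinarith
  have key := hP.exp_mul_sin_le hε0.le ht.le
    (i := ⟨0, by lia⟩) (j := ⟨1, by lia⟩) (by simp) huv m
    -- A rational point of `s² = 1 + r²` with `s - r = 1/20`, suited to an overlap near `1`.
    (r := 399 / 40) (s := 401 / 40) (by norm_num) (by norm_num)
  rw [← hT, show -2 * v ^ 2 * T = -2 * v * (v * T) by ring,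
    show 2 * u * v * T = 2 * u * (v * T) by ring, hvT] at key
  have hexp : 0.97 ≤ exp (-2 * v * (1 / 3)) := by
    linarith [add_one_le_exp (-2 * v * (1 / 3))]
  have hsin : 0.44 ≤ sin (2 * u * (1 / 3)) := by
    have h := sin_gt_sub_cube (x := 2 * u * (1 / 3)) (by linarith)
    have h3 : (2 * u * (1 / 3)) ^ 3 ≤ (0.472 : ℝ) ^ 3 := by
      gcongr
      linarith
    norm_num at h3
    linarith
  have hnm : (n : ℝ) * m * v ^ 2 ≤ 1.2e-4 := by
    have h1 : n * ε ≤ 1e-4 * t ^ 2 := by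
      have h := hn.le
      rw [← mul_div_assoc, le_div_iff₀ hε0] at h
      norm_num at h ⊢
      linarith
    have h2 : (n : ℝ) * m * v ^ 2 * (m * ε) ≤ 1e-4 / 9 := by
      calc (n : ℝ) * m * v ^ 2 * (m * ε) = n * ε * (m ^ 2 * v ^ 2) := by ring
        _ ≤ 1e-4 * t ^ 2 * (m ^ 2 * v ^ 2) := by gcongr
        _ = 1e-4 * (v * T) ^ 2 := by rw [hT]; ring
        _ = 1e-4 / 9 := by rw [hvT]; norm_num
    have h3 : 0 ≤ (n : ℝ) * m * v ^ 2 := by positivity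
    nlinarith
  have hpow : 1 - 4 * ((n : ℝ) * m * v ^ 2) ≤ (1 - 4 * v ^ 2) ^ (n * m) := by
    have h := one_add_mul_le_pow (a := -(4 * v ^ 2)) (by nlinarith) (n * m)
    push_cast at h
    rw [← sub_eq_add_neg] at h
    linarith
  -- The contradiction: this side is at least `0.4268`, while the bound in `key` is at most `0.055 +
  -- 2 · 0.139 = 0.333`.
  have hprod : 0.97 * 0.44 ≤ exp (-2 * v * (1 / 3)) * sin (2 * u * (1 / 3)) := by gcongr
  linarith

end LowerBound

end SampleSim

end

theorem theorem4 (d : ℕ) (hd : 2 ≤ d) (t ε : ℝ) (ht : 0 ≤ t)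
    (hε : ε ∈ Set.Ioc (0 : ℝ) (min 0.039 (0.013 * t))) :
    ENNReal.ofReal ((10 : ℝ) ^ (-4 : ℤ) * (t ^ 2 / ε)) ≤
      (SampleSim.sampleComplexity d t ε : ENNReal) := by
  obtain ⟨h0, h12⟩ := hε
  obtain ⟨h1, h2⟩ := le_min_iff.mp h12
  set x : ℝ := (10 : ℝ) ^ (-4 : ℤ) * (t ^ 2 / ε)
  -- Rounding `x` up allows the comparison to take place in `ℕ∞`.
  have h : ((⌈x⌉₊ : ℕ) : ℕ∞) ≤ SampleSim.sampleComplexity d t ε := by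
    refine le_iInf fun n => le_iInf fun hn => ?_
    obtain ⟨P, hP⟩ := hn
    exact_mod_cast Nat.ceil_le.mpr (hP.le_natCast hd h0 h1 h2)
  refine le_trans ?_ (ENat.toENNReal_le.mpr h)
  rw [ENat.toENNReal_coe]
  exact ENNReal.ofReal_le_of_le_toReal (by simpa using Nat.le_ceil x)
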